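/- **Theorem (Incompressible strings are simple).** Conventions. Logarithms are in base 2. A *prefix computer* is a partial computable map $(p,y)\mapsto M(p,y)$ from pairs of finite binary strings (program $p$, input $y$) to binary strings such that for every $y$ no halting program is a proper prefix of another one. Fix a universal prefix computer $U$: for every prefix computer $M$ there is a constant $c_M$ such that every $p$ has some $q$ with $\ell(q)\le\ell(p)+c_M$ and $U(q,\cdot)=M(p,\cdot)$. Let $K(x)$ be the length of a shortest $p$ with $U(p,\lambda)=x$, where $\lambda$ is the empty string, and let $K(n)$, for $n\in\mathbb N$, be the complexity of the binary numeral of $n$. An *ensemble* is a computable probability distribution $\mathbb E$ on the binary strings whose entropy $H(\mathbb E)=-\sum_s\mathbb E(s)\log\mathbb E(s)$ is finite and computable. $K(\mathbb E)$ is the length of a shortest program for $U$ which, on input a string $s$ and $m\in\mathbb N$, outputs the binary digits of an approximation of $\mathbb E(s)$ with accuracy $2^{-m}$, and which likewise, on a query for the entropy with $m\in\mathbb N$, outputs an approximation of $H(\mathbb E)$ with accuracy $2^{-m}$. Put $\Sigma(\mathbb E)=K(\mathbb E)+H(\mathbb E)$. For real $\delta,\Delta\ge 0$ and a set $\mathcal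 C$ of ensembles, $$\mathcal E_{\delta,\Delta}(x|\mathcal C)=\inf\{K(\mathbb E)\;:\;\mathbb E\in\mathcal C,\ \mathbb E(x)\ge 2^{-H(\mathbb E)(1+\delta)},\ \Sigma(\mathbb E)\le K(x)+\Delta\}$$ ($\infty$ if this set is empty), and $\mathcal E_{\delta,\Delta}(x)$ is the same quantity with $\mathcal C$ the set of all ensembles. The set $\mathcal C$ is *convex* if it contains every ensemble of the form $\sum_i\lambda_i\mathbb E_i$ (finite sum) with $\mathbb E_i\in\mathcal C$, $\lambda_i\in(0,1)$ and $\sum_i\lambda_i=1$. It is *decidable* if some algorithm decides, given a string $t$, whether the Dirac measure $\delta_t$ lies in $\mathcal C$; then $K(\mathcal C)$ is the length of a shortest program for $U$ computing this decision function. For $r\in\mathbb N$, a string $x$ of length $n$ is *$r$-incompressible* if $K(x)\ge n+K(n)-r$. Statement. There are constants $c\in\mathbb N$ and $A\ge 0$, depending only on $U$, such that for all $r\in\mathbb N$, all $\delta\ge 0$, all $n\ge 3$ and all $r$-incompressible strings $x$ of length $n$: 1. if $\Delta\ge r+c$, then $\mathcal E_{\delta,\Delta}(x)\le\log n+A\log\log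 n$; 2. for every convex and decidable set $\mathcal C$ of ensembles with $\delta_x\in\mathcal C$, if $\Delta\ge r+c+K(\mathcal C)$, then $\mathcal E_{\delta,\Delta}(x|\mathcal C)\le\log n+A\log\log n+K(\mathcal C)$. -/

import Mathlib

open scoped ENNReal NNReal

/-- Finite binary strings; the empty string is `[]`, the length is `List.length`. -/
abbrev BinStr : Type := List Bool

/-- A prefix computer with side information: a partial computable function `(p, y) ↦ M(p, y)` of a
program `p` and an input `y` such that, for every input `y`, no halting program is a proper prefix
of another one. -/
structure PrefixMachine where
  run : BinStr → BinStr →. BinStr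
  partrec : Partrec₂ run
  prefix_free : ∀ (y p t : BinStr), (run p y).Dom → (run (p ++ t) y).Dom → t = []

/-- `U` is universal: it simulates every prefix computer `M`, at the cost of a program that is
longer by at most a constant depending on `M` only. -/
def PrefixMachine.IsUniversal (U : PrefixMachine) : Prop :=
  ∀ M : PrefixMachine, ∃ c : ℕ, ∀ p : BinStr, ∃ q : BinStr,
    q.length ≤ p.length + c ∧ ∀ y : BinStr, U.run q y = M.run p y

/-- Prefix Kolmogorov complexity `K(x)` of a string (no side information: the input is empty). -/
noncomputable def PrefixMachine.K (U : PrefixMachine) (x : BinStr) : ℕ∞ :=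
  ⨅ (p : BinStr) (_ : U.run p [] = Part.some x), (p.length : ℕ∞)

/-- Prefix Kolmogorov complexity `K(n)` of a natural number, through its binary digits. -/
noncomputable def PrefixMachine.KNat (U : PrefixMachine) (n : ℕ) : ℕ∞ :=
  U.K (Nat.bits n)

/-- The numeral `a`, read as the fixed-point binary number `a / 2 ^ n`, is an approximation of `v`
with accuracy `2 ^ (-n)`. -/
def IsApprox (a n : ℕ) (v : ℝ) : Prop :=
  |v - (a : ℝ) / 2 ^ n| ≤ 1 / 2 ^ n

/-- Shannon entropy (base 2) of a probability distribution on the binary strings. -/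
noncomputable def shannonEntropy (P : PMF BinStr) : ℝ :=
  -∑' s : BinStr, (P s).toReal * Real.logb 2 (P s).toReal

/-- An ensemble: a computable probability distribution on the binary strings whose entropy is
finite and computable. -/
structure Ensemble where
  law : PMF BinStr
  computable_law : ∃ f : BinStr → ℕ → ℕ, Computable₂ f ∧
    ∀ (s : BinStr) (n : ℕ), IsApprox (f s n) n (law s).toReal
  finite_entropy : Summable fun s : BinStr => (law s).toReal * Real.logb 2 (law s).toReal
  computable_entropy : ∃ f : ℕ → ℕ, Computable f ∧
    ∀ n : ℕ, IsApprox (f n) n (shannonEntropy law)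

namespace Ensemble

/-- The probability `E(s)`. -/
noncomputable def prob (E : Ensemble) (s : BinStr) : ℝ := (E.law s).toReal

/-- The entropy `H(E)`. -/
noncomputable def entropy (E : Ensemble) : ℝ := shannonEntropy E.law

/-- The string `x` is `δ`-typical for `E`. -/
def IsTypical (E : Ensemble) (δ : ℝ≥0) (x : BinStr) : Prop :=
  (2 : ℝ) ^ (-(E.entropy * (1 + (δ : ℝ)))) ≤ E.prob x

end Ensemble

theorem PMF.pure_mul_logb_eq_zero (x s : BinStr) :
    ((PMF.pure x) s).toReal * Real.logb 2 ((PMF.pure x) s).toReal = 0 := by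
  by_cases h : s = x <;> simp [PMF.pure_apply, h]

theorem shannonEntropy_pure (x : BinStr) : shannonEntropy (PMF.pure x) = 0 := by
  simp only [shannonEntropy, PMF.pure_mul_logb_eq_zero, tsum_zero, neg_zero]

theorem computable_two_pow : Computable fun n : ℕ => 2 ^ n := by
  have h : Primrec fun n : ℕ => Nat.rec (motive := fun _ => ℕ) 1 (fun _ a => 2 * a) n := by
    refine Primrec.nat_rec₁ 1 ?_
    exact (Primrec.nat_mul.comp (Primrec.const 2) Primrec.snd).to₂
  refine h.to_comp.of_eq fun n => ?_
  induction n with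
  | zero => rfl
  | succ k ih => rw [pow_succ, ← ih, Nat.mul_comm]

/-- The Dirac measure `δ_x`. -/
noncomputable def dirac (x : BinStr) : Ensemble where
  law := PMF.pure x
  computable_law := by
    refine ⟨fun s n => bif decide (s = x) then 2 ^ n else 0, ?_, ?_⟩
    · refine Computable.cond ?_ (computable_two_pow.comp Computable.snd) (Computable.const 0)
      exact (Primrec.eq.decide.comp Primrec.fst (Primrec.const x)).to_comp
    · intro s n
      by_cases h : s = x <;> simp [IsApprox, PMF.pure_apply, h]
  finite_entropy := by
    simp only [PMF.pure_mul_logb_eq_zero]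
    exact summable_zero
  computable_entropy :=
    ⟨fun _ => 0, Computable.const 0, fun n => by simp [IsApprox, shannonEntropy_pure]⟩

/-- The input string asking a program for an ensemble for its value at `s` with accuracy
`2 ^ (-n)` (query `some s`), or for its entropy with accuracy `2 ^ (-n)` (query `none`). -/
def queryStr (o : Option BinStr) (n : ℕ) : BinStr :=
  Nat.bits (Encodable.encode (o, n))

/-- `p` is a program for `U` that computes the ensemble `E`, including a subprogram for its
entropy: on every query it halts and outputs the binary digits of an approximation. -/
def PrefixMachine.Computes (U : PrefixMachine) (p : BinStr) (E : Ensemble) : Prop :=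
  (∀ (s : BinStr) (n : ℕ), ∃ a : ℕ,
    U.run p (queryStr (some s) n) = Part.some (Nat.bits a) ∧ IsApprox a n (E.prob s)) ∧
  (∀ n : ℕ, ∃ a : ℕ,
    U.run p (queryStr none n) = Part.some (Nat.bits a) ∧ IsApprox a n E.entropy)

/-- The complexity `K(E) = K(E, H(E))` of an ensemble. -/
noncomputable def PrefixMachine.KEns (U : PrefixMachine) (E : Ensemble) : ℕ∞ :=
  ⨅ (p : BinStr) (_ : U.Computes p E), (p.length : ℕ∞)

/-- The total information `Σ(E) = K(E) + H(E)`. -/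
noncomputable def PrefixMachine.totalInfo (U : PrefixMachine) (E : Ensemble) : ℝ≥0∞ :=
  (U.KEns E : ℝ≥0∞) + ENNReal.ofReal E.entropy

/-- The minimization domain of `x` for effective complexity. -/
def PrefixMachine.minDomain (U : PrefixMachine) (δ Δ : ℝ≥0) (x : BinStr) : Set Ensemble :=
  {E | E.IsTypical δ x ∧ U.totalInfo E ≤ (U.K x : ℝ≥0∞) + (Δ : ℝ≥0∞)}

/-- The effective complexity of `x` (`⊤` if the minimization domain is empty). -/
noncomputable def PrefixMachine.effComplexity (U : PrefixMachine) (δ Δ : ℝ≥0) (x : BinStr) : ℕ∞ :=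
  ⨅ E ∈ U.minDomain δ Δ x, U.KEns E

/-- The effective complexity of `x` constrained to a set `C` of ensembles. -/
noncomputable def PrefixMachine.effComplexityOn (U : PrefixMachine) (δ Δ : ℝ≥0) (x : BinStr)
    (C : Set Ensemble) : ℕ∞ :=
  ⨅ E ∈ U.minDomain δ Δ x ∩ C, U.KEns E

/-- `C` is convex: it contains every ensemble that is a finite convex combination of members. -/
def ConvexConstraint (C : Set Ensemble) : Prop :=
  ∀ (m : ℕ) (F : Fin m → Ensemble) (w : Fin m → ℝ),
    (∀ i, F i ∈ C) → (∀ i, 0 < w i ∧ w i < 1) → ∑ i, w i = 1 →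
    ∀ E : Ensemble, (∀ s : BinStr, E.prob s = ∑ i, w i * (F i).prob s) → E ∈ C

/-- `C` is decidable: it is decidable whether the Dirac measure on a given string lies in `C`. -/
def DecidableConstraint (C : Set Ensemble) : Prop :=
  ComputablePred fun t : BinStr => dirac t ∈ C

open Classical in
/-- The complexity `K(C)`: the length of a shortest program for the decision function of `C`. -/
noncomputable def PrefixMachine.KSet (U : PrefixMachine) (C : Set Ensemble) : ℕ∞ :=
  ⨅ (p : BinStr) (_ : ∀ t : BinStr, U.run p t = Part.some [decide (dirac t ∈ C)]),
    (p.length : ℕ∞)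

/-- The string `x` is `r`-incompressible: `K(x) ≥ n + K(n) - r`, where `n` is its length. -/
def PrefixMachine.Incompressible (U : PrefixMachine) (r : ℕ) (x : BinStr) : Prop :=
  (x.length : ℕ∞) + U.KNat x.length ≤ U.K x + (r : ℕ∞)

/-! ### Primitive recursive operations on numerals and strings -/

/-! The witness is the uniform distribution on the set `S` of all strings of length `n` whose Dirac
measures lie in `C`. It belongs to `C` by convexity, its entropy is `log |S| ≤ n`, and every element
of `S` has probability exactly `2 ^ (-H)`, so `x` is typical for every `δ`.

A program for `n` followed by a program deciding `C` describes this ensemble: the first part is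
self-delimiting, and `S` and all answers are computable from the two. Hence `K(E) ≤ K(n) + K(C) +
O(1)` (`exists_uniformMachine`, `exists_KEns_le`). Therefore `Σ(E) ≤ n + K(n) + K(C) + O(1)`, which
incompressibility bounds by `K(x) + r + K(C) + O(1)`; this is the domain condition
(`effComplexityOn_le`).

The claimed bound follows from `K(n) ≤ log n + O(log log n)`, by a self-delimiting code
(`exists_KNat_le`). The unconstrained case is `C = Set.univ`, whose complexity is a constant
(`exists_KSet_univ_le`). -/

theorem primrec_nat_bits : Primrec Nat.bits := by
  -- Course-of-values recursion: `l` lists the numerals of all smaller numbers, so its length is the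
  -- current argument.
  have hg : Primrec₂ fun (_ : Unit) (l : List BinStr) =>
      if l.length = 0 then some [] else
        (l[l.length / 2]?).map fun b => decide (l.length % 2 = 1) :: b := by
    have hlen : Primrec fun a : Unit × List BinStr => a.2.length :=
      Primrec.list_length.comp Primrec.snd
    refine Primrec.ite (Primrec.eq.comp hlen (Primrec.const 0)) (Primrec.const _) ?_
    refine Primrec.option_map (Primrec.list_getElem?.comp Primrec.snd
      (Primrec.nat_div.comp hlen (Primrec.const 2))) ?_
    refine Primrec.list_cons.comp ?_ Primrec.snd
    exact (Primrec.eq.comp (Primrec.nat_mod.comp (hlen.comp Primrec.fst) (Primrec.const 2))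
      (Primrec.const 1)).decide
  have := Primrec.nat_strong_rec (fun (_ : Unit) n => Nat.bits n) hg fun _ n => by
    rcases n.eq_zero_or_pos with rfl | hn
    · simp
    · have h2 : n / 2 < n := Nat.div_lt_self hn (by norm_num)
      simp only [List.length_map, List.length_range, hn.ne', if_false, List.getElem?_map,
        List.getElem?_range h2, Option.map_some, Option.some.injEq]
      conv_rhs => rw [← Nat.div_add_mod n 2]
      rcases Nat.mod_two_eq_zero_or_one n with h | h
      · rw [h, Nat.add_zero, Nat.bit0_bits _ (by lia)]; simp
      · rw [h, Nat.bit1_bits]; simp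
  exact this.comp (Primrec.const ()) Primrec.id

/-- The number with the given binary digits, least significant digit first. -/
def BinStr.toNat (l : BinStr) : ℕ := l.foldr (fun b n => 2 * n + cond b 1 0) 0

theorem BinStr.toNat_bits (n : ℕ) : BinStr.toNat (Nat.bits n) = n := by
  induction n using Nat.strong_induction_on with
  | _ n ih =>
    rcases n.eq_zero_or_pos with rfl | hn
    · simp [BinStr.toNat]
    · have h2 : n / 2 < n := Nat.div_lt_self hn (by norm_num)
      have h := ih _ h2
      conv_lhs => rw [← Nat.div_add_mod n 2]
      rcases Nat.mod_two_eq_zero_or_one n with h' | h'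
      · rw [h', Nat.add_zero, Nat.bit0_bits _ (by lia)]
        simp only [BinStr.toNat, List.foldr_cons] at h ⊢
        rw [h]; simp; lia
      · rw [h', Nat.bit1_bits]
        simp only [BinStr.toNat, List.foldr_cons] at h ⊢
        rw [h]; simp; lia

theorem BinStr.primrec_toNat : Primrec BinStr.toNat := by
  refine Primrec.list_foldr (f := fun l : BinStr => l) (g := fun _ => 0)
    (h := fun _ (q : Bool × ℕ) => 2 * q.2 + cond q.1 1 0) Primrec.id (Primrec.const 0) ?_
  exact Primrec.nat_add.comp
    (Primrec.nat_mul.comp (Primrec.const 2) (Primrec.snd.comp Primrec.snd))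
    (Primrec.cond (Primrec.fst.comp Primrec.snd) (Primrec.const 1) (Primrec.const 0))

theorem primrec_nat_pow : Primrec₂ fun a b : ℕ => a ^ b := by
  have h : Primrec₂ fun a b : ℕ => Nat.rec (motive := fun _ => ℕ) 1 (fun _ c => c * a) b := by
    refine Primrec.nat_rec (f := fun _ => 1) (g := fun a (p : ℕ × ℕ) => p.2 * a)
      (Primrec.const 1) ?_
    exact Primrec.nat_mul.comp (Primrec.snd.comp Primrec.snd) Primrec.fst
  refine h.of_eq fun a b => ?_
  induction b with
  | zero => rfl
  | succ k ih => rw [pow_succ, ← ih]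

theorem primrec_nat_log_two : Primrec (Nat.log 2) := by
  have h : Primrec fun n : ℕ => (Nat.bits n).length - 1 :=
    Primrec.nat_sub.comp (Primrec.list_length.comp primrec_nat_bits) (Primrec.const 1)
  refine h.of_eq fun n => ?_
  rw [Nat.size_eq_bits_len]
  rcases n.eq_zero_or_pos with rfl | hn
  · simp
  · have h1 : 0 < n.size := Nat.size_pos.2 hn
    refine ((Nat.log_eq_iff (Or.inr ⟨one_lt_two, hn.ne'⟩)).2 ⟨?_, ?_⟩).symm
    · exact Nat.lt_size.1 (by lia)
    · exact Nat.size_le.1 (by lia)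

/-- Serves as a primitive recursive membership test, in the form `S.idxOf s < S.length`. The proof
only reconciles two lawful `BEq` instances. -/
theorem primrec_idxOf : Primrec₂ fun (s : BinStr) (S : List BinStr) => S.idxOf s :=
  Primrec.list_idxOf.of_eq fun s S => by
    congr 1; exact lawful_beq_subsingleton _ _

/-- All strings of length `n`. -/
def stringsOfLength : ℕ → List BinStr
  | 0 => [[]]
  | n + 1 => (stringsOfLength n).flatMap fun s => [false :: s, true :: s]

theorem primrec_stringsOfLength : Primrec stringsOfLength := by
  have h : Primrec fun n : ℕ => Nat.rec (motive := fun _ => List BinStr) [[]]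
      (fun _ l => l.flatMap fun s => [false :: s, true :: s]) n := by
    refine Primrec.nat_rec₁ _ ?_
    refine Primrec.list_flatMap Primrec.snd ?_
    exact Primrec.list_cons.comp (Primrec.list_cons.comp (Primrec.const false) Primrec.snd)
      (Primrec.list_cons.comp (Primrec.list_cons.comp (Primrec.const true) Primrec.snd)
        (Primrec.const []))
  refine h.of_eq fun n => ?_
  induction n with
  | zero => rfl
  | succ k ih => rw [stringsOfLength, ← ih]

theorem mem_stringsOfLength {n : ℕ} {s : BinStr} : s ∈ stringsOfLength n ↔ s.length = n := by
  induction n generalizing s with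
  | zero => simp [stringsOfLength]
  | succ k ih =>
    simp only [stringsOfLength, List.mem_flatMap, ih, List.mem_cons, List.not_mem_nil, or_false]
    rcases s with _ | ⟨_ | _, s⟩ <;> simp

theorem length_stringsOfLength (n : ℕ) : (stringsOfLength n).length = 2 ^ n := by
  induction n with
  | zero => rfl
  | succ k ih => simp [stringsOfLength, List.length_flatMap, ih, pow_succ]

theorem nodup_stringsOfLength (n : ℕ) : (stringsOfLength n).Nodup := by
  induction n with
  | zero => simp [stringsOfLength]
  | succ k ih =>
    rw [stringsOfLength, List.nodup_flatMap]
    refine ⟨fun s _ => by simp, ih.imp fun {a b} hab => ?_⟩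
    simp [Function.onFun, List.disjoint_left, hab]

/-! ### Uniform ensembles -/

/-- The answer to the query `y` about the uniform distribution on the list `S`. -/
def uniformAnswer (S : List BinStr) (y : BinStr) : BinStr :=
  match (Encodable.decode (BinStr.toNat y) : Option (Option BinStr × ℕ)) with
  | none => []
  | some (none, m) => Nat.bits (Nat.log 2 (S.length ^ 2 ^ m))
  | some (some s, m) => Nat.bits (if S.idxOf s < S.length then 2 ^ m / S.length else 0)

theorem primrec_uniformAnswer : Primrec₂ uniformAnswer := by
  have hlen {β : Type} [Primcodable β] {f : β → List BinStr} (hf : Primrec f) :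
    Primrec fun b => (f b).length := Primrec.list_length.comp hf
  have hpow {β : Type} [Primcodable β] {f : β → ℕ} (hf : Primrec f) :
    Primrec fun b => 2 ^ f b := primrec_nat_pow.comp (Primrec.const 2) hf
  have h1 : Primrec₂ fun (a : List BinStr × BinStr) (q : Option BinStr × ℕ) =>
      (Option.casesOn (motive := fun _ => BinStr) q.1
        (Nat.bits (Nat.log 2 (a.1.length ^ 2 ^ q.2)))
        (fun s => Nat.bits (if a.1.idxOf s < a.1.length then 2 ^ q.2 / a.1.length else 0))) := by
    refine Primrec.option_casesOn (Primrec.fst.comp Primrec.snd) ?_ ?_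
    · exact primrec_nat_bits.comp (primrec_nat_log_two.comp (primrec_nat_pow.comp
        (hlen (Primrec.fst.comp Primrec.fst)) (hpow (Primrec.snd.comp Primrec.snd))))
    · have hS := hlen (Primrec.fst.comp (Primrec.fst.comp (Primrec.fst
        (α := (List BinStr × BinStr) × (Option BinStr × ℕ)) (β := BinStr))))
      refine primrec_nat_bits.comp (Primrec.ite (Primrec.nat_lt.comp (primrec_idxOf.comp
        Primrec.snd (Primrec.fst.comp (Primrec.fst.comp Primrec.fst))) hS)
        (Primrec.nat_div.comp (hpow (Primrec.snd.comp (Primrec.snd.comp Primrec.fst))) hS)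
        (Primrec.const 0))
  have h2 := Primrec.option_casesOn (Primrec.decode.comp (BinStr.primrec_toNat.comp Primrec.snd))
    (Primrec.const []) h1
  refine Primrec.of_eq h2 fun ⟨S, y⟩ => ?_
  simp only [uniformAnswer]
  rcases (Encodable.decode (BinStr.toNat y) : Option (Option BinStr × ℕ)) with
    _ | ⟨_ | s, m⟩ <;> rfl

theorem uniformAnswer_entropy (S : List BinStr) (m : ℕ) :
    uniformAnswer S (queryStr none m) = Nat.bits (Nat.log 2 (S.length ^ 2 ^ m)) := by
  simp [uniformAnswer, queryStr, BinStr.toNat_bits]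

theorem uniformAnswer_prob (S : List BinStr) (s : BinStr) (m : ℕ) :
    uniformAnswer S (queryStr (some s) m) =
      Nat.bits (if s ∈ S then 2 ^ m / S.length else 0) := by
  simp [uniformAnswer, queryStr, BinStr.toNat_bits, List.idxOf_lt_length_iff]

/-- The numeral is the floor of `2 ^ m * log N`, obtained by integer arithmetic alone, so the error
is below one unit of the last place. -/
theorem isApprox_log {N : ℕ} (hN : 0 < N) (m : ℕ) :
    IsApprox (Nat.log 2 (N ^ 2 ^ m)) m (Real.logb 2 N) := by
  set a := Nat.log 2 (N ^ 2 ^ m) with ha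
  have hpos : (0 : ℝ) < 2 ^ m := by positivity
  have hN' : (0 : ℝ) < N := by exact_mod_cast hN
  have h1 : (a : ℝ) ≤ 2 ^ m * Real.logb 2 N := by
    have := Nat.pow_log_le_self 2 (x := N ^ 2 ^ m) (by positivity)
    have h : (2 : ℝ) ^ (a : ℝ) ≤ (N : ℝ) ^ 2 ^ m := by
      rw [Real.rpow_natCast]; exact_mod_cast this
    rw [← Real.le_logb_iff_rpow_le one_lt_two (by positivity), Real.logb_pow] at h
    exact_mod_cast h
  have h2 : 2 ^ m * Real.logb 2 N < a + 1 := by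
    have := Nat.lt_pow_succ_log_self (b := 2) one_lt_two (N ^ 2 ^ m)
    have h : (N : ℝ) ^ 2 ^ m < (2 : ℝ) ^ ((a + 1 : ℕ) : ℝ) := by
      rw [Real.rpow_natCast]; exact_mod_cast this
    rw [← Real.logb_lt_iff_lt_rpow one_lt_two (by positivity), Real.logb_pow] at h
    exact_mod_cast h
  rw [IsApprox, abs_le]
  have e : Real.logb 2 N - a / 2 ^ m = (2 ^ m * Real.logb 2 N - a) / 2 ^ m := by field_simp
  rw [e]
  constructor
  · exact (neg_nonpos.2 (by positivity)).trans (div_nonneg (by linarith) hpos.le)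
  · gcongr; linarith

theorem isApprox_inv {N : ℕ} (hN : 0 < N) (m : ℕ) : IsApprox (2 ^ m / N) m (N : ℝ)⁻¹ := by
  have hpos : (0 : ℝ) < 2 ^ m := by positivity
  have hN' : (0 : ℝ) < N := by exact_mod_cast hN
  have h1 : ((2 ^ m / N : ℕ) : ℝ) ≤ 2 ^ m / N := by exact_mod_cast Nat.cast_div_le
  have h2 : (2 ^ m / N : ℝ) < (2 ^ m / N : ℕ) + 1 := by
    rw [div_lt_iff₀ hN']
    exact_mod_cast Nat.lt_mul_of_div_lt (Nat.lt_succ_self _) hN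
  rw [IsApprox, abs_le]
  have e : (N : ℝ)⁻¹ - (2 ^ m / N : ℕ) / 2 ^ m = (2 ^ m / N - (2 ^ m / N : ℕ)) / 2 ^ m := by
    field_simp
  rw [e]
  constructor
  · exact (neg_nonpos.2 (by positivity)).trans (div_nonneg (by linarith) hpos.le)
  · gcongr; linarith

theorem toReal_uniformOfFinset (S : Finset BinStr) (hS : S.Nonempty) (s : BinStr) :
    ((PMF.uniformOfFinset S hS) s).toReal = if s ∈ S then (S.card : ℝ)⁻¹ else 0 := by
  rw [PMF.uniformOfFinset_apply]; split_ifs <;> simp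

theorem hasSum_uniformOfFinset_mul_logb (S : Finset BinStr) (hS : S.Nonempty) :
    HasSum (fun s : BinStr => ((PMF.uniformOfFinset S hS) s).toReal *
      Real.logb 2 ((PMF.uniformOfFinset S hS) s).toReal) (-Real.logb 2 S.card) := by
  have hc : (S.card : ℝ) ≠ 0 := by exact_mod_cast hS.card_pos.ne'
  have e : -Real.logb 2 S.card = ∑ s ∈ S, ((PMF.uniformOfFinset S hS) s).toReal *
      Real.logb 2 ((PMF.uniformOfFinset S hS) s).toReal := ?_
  · rw [e]
    exact hasSum_sum_of_ne_finset_zero fun s hs => by simp [hs]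
  rw [Finset.sum_congr rfl fun s hs => by rw [toReal_uniformOfFinset, if_pos hs]]
  simp [hc]

theorem shannonEntropy_uniformOfFinset (S : Finset BinStr) (hS : S.Nonempty) :
    shannonEntropy (PMF.uniformOfFinset S hS) = Real.logb 2 S.card := by
  rw [shannonEntropy, (hasSum_uniformOfFinset_mul_logb S hS).tsum_eq, neg_neg]

/-- The uniform distribution on a nonempty finite set of strings. -/
noncomputable def uniformEnsemble (S : Finset BinStr) (hS : S.Nonempty) : Ensemble where
  law := PMF.uniformOfFinset S hS
  computable_law := by
    refine ⟨fun s m => if S.toList.idxOf s < S.toList.length then 2 ^ m / S.card else 0, ?_, ?_⟩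
    · refine Primrec.to_comp (Primrec.ite (Primrec.nat_lt.comp (primrec_idxOf.comp
        Primrec.fst (Primrec.const _)) (Primrec.const _)) (Primrec.nat_div.comp
        (primrec_nat_pow.comp (Primrec.const 2) Primrec.snd) (Primrec.const _))
        (Primrec.const 0))
    · intro s m
      simp only [List.idxOf_lt_length_iff, Finset.mem_toList, toReal_uniformOfFinset]
      split_ifs
      · exact isApprox_inv hS.card_pos m
      · simp [IsApprox]
  finite_entropy := (hasSum_uniformOfFinset_mul_logb S hS).summable
  computable_entropy := by
    refine ⟨fun m => Nat.log 2 (S.card ^ 2 ^ m), ?_, fun m => ?_⟩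
    · exact (primrec_nat_log_two.comp (primrec_nat_pow.comp (Primrec.const _)
        (primrec_nat_pow.comp (Primrec.const 2) Primrec.id))).to_comp
    · rw [shannonEntropy_uniformOfFinset]
      exact isApprox_log hS.card_pos m

theorem uniformEnsemble_entropy (S : Finset BinStr) (hS : S.Nonempty) :
    (uniformEnsemble S hS).entropy = Real.logb 2 S.card :=
  shannonEntropy_uniformOfFinset S hS

theorem uniformEnsemble_prob (S : Finset BinStr) (hS : S.Nonempty) (s : BinStr) :
    (uniformEnsemble S hS).prob s = if s ∈ S then (S.card : ℝ)⁻¹ else 0 :=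
  toReal_uniformOfFinset S hS s

/-- The inequality is an equality at `δ = 0`; a larger `δ` only lowers the threshold because the
entropy is nonnegative. -/
theorem uniformEnsemble_isTypical {S : Finset BinStr} (hS : S.Nonempty) {x : BinStr} (hx : x ∈ S)
    (δ : ℝ≥0) : (uniformEnsemble S hS).IsTypical δ x := by
  have hc : (1 : ℝ) ≤ S.card := by exact_mod_cast hS.card_pos
  have hl : 0 ≤ Real.logb 2 S.card := Real.logb_nonneg one_lt_two hc
  rw [Ensemble.IsTypical, uniformEnsemble_prob, if_pos hx, uniformEnsemble_entropy]
  calc (2 : ℝ) ^ (-(Real.logb 2 S.card * (1 + (δ : ℝ)))) ≤ 2 ^ (-Real.logb 2 S.card) := by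
        refine Real.rpow_le_rpow_of_exponent_le one_le_two (neg_le_neg ?_)
        nlinarith [mul_nonneg hl δ.coe_nonneg]
    _ = (S.card : ℝ)⁻¹ := by
        rw [Real.rpow_neg two_pos.le, Real.rpow_logb two_pos (by norm_num) (by linarith)]

/-- A program that answers all queries about the uniform distribution on `S` computes it. -/
theorem PrefixMachine.computes_uniformEnsemble (U : PrefixMachine) {p : BinStr}
    (l : List BinStr) (hl : l.Nodup) (hS : l.toFinset.Nonempty)
    (hp : ∀ y, U.run p y = Part.some (uniformAnswer l y)) :
    U.Computes p (uniformEnsemble l.toFinset hS) := by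
  have hc : l.toFinset.card = l.length := List.toFinset_card_of_nodup hl
  have hpos : 0 < l.length := hc ▸ hS.card_pos
  refine ⟨fun s m => ⟨_, (hp _).trans (by rw [uniformAnswer_prob]), ?_⟩,
    fun m => ⟨_, (hp _).trans (by rw [uniformAnswer_entropy]), ?_⟩⟩
  · rw [uniformEnsemble_prob, hc]
    simp only [List.mem_toFinset]
    split_ifs
    · exact isApprox_inv hpos m
    · simp [IsApprox]
  · rw [uniformEnsemble_entropy, hc]
    exact isApprox_log hpos m

theorem Ensemble.ext_prob {E F : Ensemble} (h : ∀ s, E.prob s = F.prob s) : E = F := by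
  have : E.law = F.law := PMF.ext fun s =>
    (ENNReal.toReal_eq_toReal_iff' (PMF.apply_ne_top _ _) (PMF.apply_ne_top _ _)).1 (h s)
  cases E; cases F; cases this; rfl

/-- A convex set of ensembles contains the uniform distribution on any nonempty finite set of
strings whose Dirac measures it contains. -/
theorem ConvexConstraint.uniformEnsemble_mem {C : Set Ensemble} (hC : ConvexConstraint C)
    {S : Finset BinStr} (hS : S.Nonempty) (h : ∀ s ∈ S, dirac s ∈ C) :
    uniformEnsemble S hS ∈ C := by
  have hdirac (t s : BinStr) : (dirac t).prob s = if s = t then 1 else 0 := by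
    rw [Ensemble.prob, dirac, PMF.pure_apply]; split_ifs <;> simp
  have hne : (S.card : ℝ) ≠ 0 := by exact_mod_cast hS.card_pos.ne'
  -- Convexity demands weights strictly below 1, so a singleton is treated apart: there the uniform
  -- ensemble is itself a Dirac measure.
  rcases (Nat.one_le_iff_ne_zero.2 hS.card_pos.ne').eq_or_lt with h1 | h1
  · obtain ⟨t, rfl⟩ := Finset.card_eq_one.1 h1.symm
    convert h t (by simp)
    refine Ensemble.ext_prob fun s => ?_
    simp [uniformEnsemble_prob, hdirac]
  · refine hC S.card (fun i => dirac (S.equivFin.symm i)) (fun _ => (S.card : ℝ)⁻¹)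
      (fun i => h _ (S.equivFin.symm i).2) (fun _ => ⟨by positivity, ?_⟩) (by simp [hne])
      _ fun s => ?_
    · exact inv_lt_one_of_one_lt₀ (by exact_mod_cast h1)
    · rw [uniformEnsemble_prob, Equiv.sum_comp S.equivFin.symm
        (fun t => (S.card : ℝ)⁻¹ * (dirac (t : BinStr)).prob s),
        Finset.sum_coe_sort S (fun t => (S.card : ℝ)⁻¹ * (dirac t).prob s)]
      simp [hdirac]

/-! ### Combining a program for a number with a program for a decision function -/

/-- Two initial segments of one string are comparable, so prefix-freeness leaves room for only one
halting program among them. -/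
theorem PrefixMachine.eq_of_append_eq (U : PrefixMachine) {y p q s t : BinStr}
    (h : p ++ s = q ++ t) (hp : (U.run p y).Dom) (hq : (U.run q y).Dom) : p = q := by
  rcases List.append_eq_append_iff.1 h with ⟨a, rfl, _⟩ | ⟨a, rfl, _⟩
  · rw [U.prefix_free _ _ _ hp hq, List.append_nil]
  · rw [U.prefix_free _ _ _ hq hp, List.append_nil]

/-- Splitting off an initial segment that is a halting program. -/
theorem PrefixMachine.exists_split (U : PrefixMachine) :
    ∃ F : BinStr →. BinStr × BinStr, Partrec F ∧
      ∀ p q o, (q, o) ∈ F p ↔ ∃ p', p = p' ++ q ∧ o ∈ U.run p' [] := by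
  have hG : Partrec fun p : BinStr => U.run p [] :=
    U.partrec.comp Computable.id (Computable.const [])
  obtain ⟨c, hc⟩ := Nat.Partrec.Code.exists_code.1 hG
  have hc' (p : BinStr) : c.eval (Encodable.encode p) = (U.run p []).map Encodable.encode := by
    rw [hc]; simp
  -- Dovetailing: `m` encodes the length of the candidate segment and a bound for the evaluation.
  let search (p : BinStr) (m : ℕ) : Option (BinStr × BinStr) :=
    (Nat.Partrec.Code.evaln m.unpair.2 c (Encodable.encode (p.take m.unpair.1))).bind fun k =>
      (Encodable.decode k : Option BinStr).map fun o => (p.drop m.unpair.1, o)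
  have hmem (p q o m) (h : (q, o) ∈ search p m) :
      p = p.take m.unpair.1 ++ q ∧ o ∈ U.run (p.take m.unpair.1) [] := by
    simp only [search, Option.mem_def, Option.bind_eq_some_iff, Option.map_eq_some_iff,
      Prod.mk.injEq] at h
    obtain ⟨k, hk, o', ho, rfl, rfl⟩ := h
    refine ⟨(List.take_append_drop _ _).symm, ?_⟩
    have := Nat.Partrec.Code.evaln_sound hk
    rw [hc', Part.mem_map_iff] at this
    obtain ⟨o'', h1, rfl⟩ := this
    simp only [Encodable.encodek, Option.some.injEq] at ho
    exact ho ▸ h1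
  have hsearch : Primrec₂ search := by
    have hm1 : Primrec fun a : BinStr × ℕ => a.2.unpair.1 :=
      Primrec.fst.comp (Primrec.unpair.comp Primrec.snd)
    have hm2 : Primrec fun a : BinStr × ℕ => a.2.unpair.2 :=
      Primrec.snd.comp (Primrec.unpair.comp Primrec.snd)
    refine Primrec.option_bind ?_ (Primrec.option_map (Primrec.decode.comp Primrec.snd) ?_)
    · exact Nat.Partrec.Code.primrec_evaln.comp (Primrec.pair (Primrec.pair hm2 (Primrec.const c))
        (Primrec.encode.comp (Primrec.list_take.comp hm1 Primrec.fst)))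
    · refine Primrec.pair (Primrec.list_drop.comp ?_ ?_) Primrec.snd
      · exact hm1.comp (Primrec.fst.comp Primrec.fst)
      · exact Primrec.fst.comp (Primrec.fst.comp Primrec.fst)
  refine ⟨fun p => Nat.rfindOpt (search p), Partrec.rfindOpt hsearch.to_comp, fun p q o => ?_⟩
  constructor
  · intro h
    obtain ⟨m, hm⟩ := Nat.rfindOpt_spec h
    exact ⟨_, hmem _ _ _ _ hm⟩
  · rintro ⟨p', rfl, ho⟩
    have hev : Encodable.encode o ∈ c.eval (Encodable.encode p') := by
      rw [hc']; exact Part.mem_map _ ho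
    obtain ⟨k, hk⟩ := Nat.Partrec.Code.evaln_complete.1 hev
    have hs : (q, o) ∈ search (p' ++ q) (Nat.pair p'.length k) := by
      have hk' : Nat.Partrec.Code.evaln k c (Encodable.encode p') = some (Encodable.encode o) := hk
      simp [search, hk']
    -- The search may stop at another index, but the halting segment is unique, so it returns the
    -- same split.
    obtain ⟨⟨q', o'⟩, h'⟩ := Part.dom_iff_mem.1 (Nat.rfindOpt_dom.2 ⟨_, _, hs⟩)
    obtain ⟨m, hm⟩ := Nat.rfindOpt_spec h'
    obtain ⟨h1, h2⟩ := hmem _ _ _ _ hm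
    have e := U.eq_of_append_eq h1 (Part.dom_iff_mem.2 ⟨_, ho⟩) (Part.dom_iff_mem.2 ⟨_, h2⟩)
    rw [← e] at h1 h2
    obtain rfl := List.append_cancel_left h1
    obtain rfl := Part.mem_unique ho h2
    exact h'

/-- Filtering a list of strings by the answers of a program. -/
theorem PrefixMachine.exists_filter (U : PrefixMachine) :
    ∃ F : BinStr × List BinStr →. List BinStr, Partrec F ∧
      ∀ (p : BinStr) (f : BinStr → Bool) (l : List BinStr), (∀ t, U.run p t = Part.some [f t]) →
        F (p, l) = Part.some (l.filter f) := by
  -- One step of a recursion over list positions, since the test is only partial recursive.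
  -- Positions stay below the length, so the default of `getI` never matters.
  let step (a : BinStr × List BinStr) (b : ℕ × List BinStr) : Part (List BinStr) :=
    (U.run a.1 (a.2.getI b.1)).map fun o => if o = [true] then b.2 ++ [a.2.getI b.1] else b.2
  have hstep : Partrec₂ step := by
    have hget : Primrec fun q : (BinStr × List BinStr) × (ℕ × List BinStr) => q.1.2.getI q.2.1 :=
      Primrec.list_getI.comp (Primrec.snd.comp Primrec.fst) (Primrec.fst.comp Primrec.snd)
    refine Partrec.map (U.partrec.comp (Computable.fst.comp Computable.fst) hget.to_comp) ?_
    refine Primrec.to_comp (Primrec.ite (Primrec.eq.comp Primrec.snd (Primrec.const [true])) ?_ ?_)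
    · exact Primrec.list_concat.comp (Primrec.snd.comp (Primrec.snd.comp Primrec.fst))
        (hget.comp Primrec.fst)
    · exact Primrec.snd.comp (Primrec.snd.comp Primrec.fst)
  refine ⟨_, Partrec.nat_rec (f := fun a => a.2.length) (g := fun _ => Part.some []) (h := step)
    (Computable.list_length.comp Computable.snd) (Computable.const []) hstep, fun p f l h => ?_⟩
  have key (k : ℕ) (hk : k ≤ l.length) : (Nat.rec (motive := fun _ => Part (List BinStr))
      (Part.some []) (fun y IH => IH.bind fun i => step (p, l) (y, i)) k) =
      Part.some ((l.take k).filter f) := by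
    induction k with
    | zero => simp
    | succ k ih =>
      have hk' : k < l.length := hk
      simp only [ih hk'.le, Part.bind_some]
      simp only [step, h, Part.map_some, Part.some_inj, List.getI_eq_getElem _ hk',
        List.take_add_one, List.getElem?_eq_getElem hk', Option.toList_some, List.filter_append]
      cases hf : f l[k] <;> simp [hf]
  simpa using key l.length le_rfl

open Classical in
/-- The strings of length `n` whose Dirac measures lie in `C`. -/
noncomputable def constraintStrings (C : Set Ensemble) (n : ℕ) : List BinStr :=
  (stringsOfLength n).filter fun t => decide (dirac t ∈ C)

theorem mem_constraintStrings {C : Set Ensemble} {n : ℕ} {t : BinStr} :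
    t ∈ constraintStrings C n ↔ t.length = n ∧ dirac t ∈ C := by
  simp [constraintStrings, mem_stringsOfLength]

theorem nodup_constraintStrings (C : Set Ensemble) (n : ℕ) : (constraintStrings C n).Nodup :=
  (nodup_stringsOfLength n).filter _

theorem length_constraintStrings_le (C : Set Ensemble) (n : ℕ) :
    (constraintStrings C n).length ≤ 2 ^ n :=
  (List.length_filter_le _ _).trans (length_stringsOfLength n).le

theorem ENat.exists_eq_iInf_length {P : BinStr → Prop}
    (h : (⨅ (p : BinStr) (_ : P p), (p.length : ℕ∞)) ≠ ⊤) :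
    ∃ p, P p ∧ (p.length : ℕ∞) = ⨅ (p : BinStr) (_ : P p), (p.length : ℕ∞) := by
  rw [iInf_subtype' (p := P) (f := fun p _ => (p.length : ℕ∞))] at h ⊢
  rcases isEmpty_or_nonempty {p // P p} with he | he
  · exact (h (iInf_of_empty _)).elim
  · obtain ⟨⟨p, hp⟩, e⟩ := ciInf_mem fun p : {p // P p} => ((p : BinStr).length : ℕ∞)
    exact ⟨p, hp, e⟩

open Classical in
/-- The machine that reads a program for a number `n` followed by a program for the decision
function of `C`, and answers queries about the uniform distribution on `constraintStrings C n`. -/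
theorem PrefixMachine.exists_uniformMachine (U : PrefixMachine) :
    ∃ M : PrefixMachine, ∀ (p q : BinStr) (n : ℕ) (C : Set Ensemble),
      U.run p [] = Part.some (Nat.bits n) →
      (∀ t : BinStr, U.run q t = Part.some [decide (dirac t ∈ C)]) →
      ∀ y, M.run (p ++ q) y = Part.some (uniformAnswer (constraintStrings C n) y) := by
  obtain ⟨F, hF, hF'⟩ := U.exists_split
  obtain ⟨G, hG, hG'⟩ := U.exists_filter
  -- The discarded run on `[]` forces the second part to be a halting program of `U` on a fixed
  -- input. This gives prefix-freeness even where the filter's behaviour is unspecified.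
  let run (p y : BinStr) : Part BinStr := (F p).bind fun a => (U.run a.1 []).bind fun _ =>
    (G (a.1, stringsOfLength a.2.toNat)).map fun l => uniformAnswer l y
  have hrun : Partrec₂ run := by
    refine Partrec.bind (hF.comp Computable.fst) (Partrec.bind (U.partrec.comp
      (Computable.fst.comp Computable.snd) (Computable.const [])) (Partrec.map (hG.comp ?_) ?_))
    · have h2 : Primrec fun a : ((BinStr × BinStr) × (BinStr × BinStr)) × BinStr => a.1.2 :=
        Primrec.snd.comp Primrec.fst
      exact (Primrec.pair (Primrec.fst.comp h2) (primrec_stringsOfLength.comp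
        (BinStr.primrec_toNat.comp (Primrec.snd.comp h2)))).to_comp
    · exact (primrec_uniformAnswer.comp Primrec.snd (Primrec.snd.comp (Primrec.fst.comp
        (Primrec.fst.comp Primrec.fst)))).to_comp
  have hdom {p y : BinStr} (h : (run p y).Dom) :
      ∃ p' q, p = p' ++ q ∧ (U.run p' []).Dom ∧ (U.run q []).Dom := by
    obtain ⟨b, hb⟩ := Part.dom_iff_mem.1 h
    obtain ⟨⟨q, o⟩, hqo, hb⟩ := Part.mem_bind_iff.1 hb
    obtain ⟨b', hb', -⟩ := Part.mem_bind_iff.1 hb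
    obtain ⟨p', rfl, ho⟩ := (hF' _ _ _).1 hqo
    exact ⟨p', q, rfl, Part.dom_iff_mem.2 ⟨_, ho⟩, Part.dom_iff_mem.2 ⟨_, hb'⟩⟩
  refine ⟨⟨run, hrun, fun y p t hp ht => ?_⟩, fun p q n C hp hq y => ?_⟩
  · obtain ⟨p₁, q₁, rfl, h1, h2⟩ := hdom hp
    obtain ⟨p₂, q₂, e, h3, h4⟩ := hdom ht
    rw [List.append_assoc] at e
    obtain rfl := U.eq_of_append_eq e h1 h3
    rw [← List.append_cancel_left e] at h4
    exact U.prefix_free _ _ _ h2 h4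
  · have h1 : F (p ++ q) = Part.some (q, Nat.bits n) :=
      Part.eq_some_iff.2 ((hF' _ _ _).2 ⟨p, rfl, hp ▸ Part.mem_some _⟩)
    simp only [run, h1, Part.bind_some, hq, BinStr.toNat_bits, hG' q _ _ hq, Part.map_some]
    rfl

/-- Concatenates shortest programs for `n` and for `C`. One fixed machine reads all such pairs, so
the constant is independent of both. -/
theorem PrefixMachine.IsUniversal.exists_KEns_le {U : PrefixMachine} (hU : U.IsUniversal) :
    ∃ c : ℕ, ∀ (n : ℕ) (C : Set Ensemble) (hS : (constraintStrings C n).toFinset.Nonempty),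
      U.KEns (uniformEnsemble (constraintStrings C n).toFinset hS) ≤
        U.KNat n + U.KSet C + c := by
  obtain ⟨M, hM⟩ := U.exists_uniformMachine
  obtain ⟨c, hc⟩ := hU M
  refine ⟨c, fun n C hS => ?_⟩
  by_cases hn : U.KNat n = ⊤
  · simp [hn]
  by_cases hC : U.KSet C = ⊤
  · simp [hC]
  obtain ⟨p, hp, hpn⟩ := ENat.exists_eq_iInf_length hn
  obtain ⟨q, hq, hqn⟩ := ENat.exists_eq_iInf_length hC
  obtain ⟨t, ht, hrun⟩ := hc (p ++ q)
  have hcomp : U.Computes t (uniformEnsemble (constraintStrings C n).toFinset hS) :=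
    U.computes_uniformEnsemble _ (nodup_constraintStrings C n) hS fun y =>
      (hrun y).trans (hM p q n C hp hq y)
  refine (iInf₂_le t hcomp).trans ?_
  rw [PrefixMachine.KNat, PrefixMachine.K, PrefixMachine.KSet, ← hpn, ← hqn]
  rw [List.length_append] at ht
  exact_mod_cast ht

/-! ### The complexity of natural numbers -/

/-- A self-delimiting code for natural numbers: the length of the length of the numeral in unary,
the length of the numeral in binary, and the numeral. -/
def selfDelimit (n : ℕ) : BinStr :=
  List.replicate (Nat.bits (Nat.bits n).length).length true ++
    false :: (Nat.bits (Nat.bits n).length ++ Nat.bits n)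

theorem length_selfDelimit (n : ℕ) :
    (selfDelimit n).length = 2 * Nat.size (Nat.size n) + 1 + Nat.size n := by
  simp only [selfDelimit, List.length_append, List.length_cons, List.length_replicate,
    Nat.size_eq_bits_len]
  lia

theorem primrec_selfDelimit : Primrec selfDelimit := by
  have h1 : Primrec fun n : ℕ => Nat.bits (Nat.bits n).length :=
    primrec_nat_bits.comp (Primrec.list_length.comp primrec_nat_bits)
  have h2 : Primrec fun n : ℕ => (List.range (Nat.bits (Nat.bits n).length).length).map
      fun _ => true :=
    Primrec.list_map (Primrec.list_range.comp (Primrec.list_length.comp h1))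
      (Primrec.const true)
  refine (Primrec.list_append.comp h2 (Primrec.list_cons.comp (Primrec.const false)
    (Primrec.list_append.comp h1 primrec_nat_bits))).of_eq fun n => ?_
  simp [selfDelimit, List.map_const']

theorem replicate_append_false_cons_inj {a b : ℕ} {u v : BinStr}
    (h : List.replicate a true ++ false :: u = List.replicate b true ++ false :: v) :
    a = b ∧ u = v := by
  induction a generalizing b with
  | zero => cases b <;> simp_all [List.replicate_succ]
  | succ a ih =>
    cases b with
    | zero => simp [List.replicate_succ] at h
    | succ b =>
      simp only [List.replicate_succ, List.cons_append, List.cons.injEq, true_and] at h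
      obtain ⟨rfl, rfl⟩ := ih h
      exact ⟨rfl, rfl⟩

theorem Nat.bits_injective : Function.Injective Nat.bits :=
  Function.LeftInverse.injective BinStr.toNat_bits

/-- Read from the left, the unary block fixes the width of the length field, and that field fixes
the width of the numeral. -/
theorem selfDelimit_prefix_free {m n : ℕ} {t : BinStr} (h : selfDelimit m ++ t = selfDelimit n) :
    m = n ∧ t = [] := by
  simp only [selfDelimit, List.append_assoc, List.cons_append] at h
  obtain ⟨h1, h2⟩ := replicate_append_false_cons_inj h
  obtain ⟨h3, h4⟩ := List.append_inj h2 h1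
  have h5 := List.append_inj (h4.trans (List.append_nil _).symm) (Nat.bits_injective h3)
  exact ⟨Nat.bits_injective h5.1, h5.2⟩

theorem exists_selfDelimitMachine :
    ∃ M : PrefixMachine, ∀ n y, M.run (selfDelimit n) y = Part.some (Nat.bits n) := by
  let search (a : BinStr × BinStr) (m : ℕ) : Option BinStr :=
    if selfDelimit m = a.1 then some (Nat.bits m) else none
  have hsearch : Primrec₂ search :=
    Primrec.ite (Primrec.eq.comp (primrec_selfDelimit.comp Primrec.snd)
      (Primrec.fst.comp Primrec.fst))
      (Primrec.option_some.comp (primrec_nat_bits.comp Primrec.snd)) (Primrec.const none)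
  have hmem {a o m} (h : o ∈ search a m) : selfDelimit m = a.1 ∧ Nat.bits m = o := by
    simpa [search] using h
  refine ⟨⟨fun p y => Nat.rfindOpt (search (p, y)), Partrec.rfindOpt hsearch.to_comp,
    fun y p t hp ht => ?_⟩, fun n y => ?_⟩
  · obtain ⟨m, o, hm⟩ := Nat.rfindOpt_dom.1 hp
    obtain ⟨k, o', hk⟩ := Nat.rfindOpt_dom.1 ht
    exact (selfDelimit_prefix_free ((congrArg (· ++ t) (hmem hm).1).trans (hmem hk).1.symm)).2
  · have hd : (Nat.rfindOpt (search (selfDelimit n, y))).Dom :=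
      Nat.rfindOpt_dom.2 ⟨n, Nat.bits n, by simp [search]⟩
    obtain ⟨o, ho⟩ := Part.dom_iff_mem.1 hd
    obtain ⟨m, hm⟩ := Nat.rfindOpt_spec ho
    obtain ⟨h1, rfl⟩ := hmem hm
    obtain ⟨rfl, -⟩ := selfDelimit_prefix_free (t := []) ((List.append_nil _).trans h1)
    exact Part.eq_some_iff.2 ho

theorem PrefixMachine.IsUniversal.exists_KNat_le {U : PrefixMachine} (hU : U.IsUniversal) :
    ∃ c : ℕ, ∀ n : ℕ, U.KNat n ≤ (Nat.size n + 2 * Nat.size (Nat.size n) + c : ℕ) := by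
  obtain ⟨M, hM⟩ := exists_selfDelimitMachine
  obtain ⟨c, hc⟩ := hU M
  refine ⟨c + 1, fun n => ?_⟩
  obtain ⟨q, hq, hrun⟩ := hc (selfDelimit n)
  refine (iInf₂_le q ((hrun []).trans (hM n []))).trans ?_
  rw [length_selfDelimit] at hq
  exact_mod_cast (by lia : q.length ≤ Nat.size n + 2 * Nat.size (Nat.size n) + (c + 1))

/-- A machine that halts only on the empty program, answering `[true]` to every input, is trivially
prefix-free. -/
theorem PrefixMachine.IsUniversal.exists_KSet_univ_le {U : PrefixMachine} (hU : U.IsUniversal) :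
    ∃ c : ℕ, U.KSet Set.univ ≤ c := by
  let search (a : BinStr × BinStr) (_ : ℕ) : Option BinStr := if a.1 = [] then some [true] else none
  have hsearch : Primrec₂ search := Primrec.ite (Primrec.eq.comp (Primrec.fst.comp Primrec.fst)
    (Primrec.const [])) (Primrec.const (some [true])) (Primrec.const none)
  have hdom {p y} (h : (Nat.rfindOpt (search (p, y))).Dom) : p = [] := by
    obtain ⟨_, o, hm⟩ := Nat.rfindOpt_dom.1 h
    by_contra hp
    simp [search, hp] at hm
  let M : PrefixMachine := ⟨fun p y => Nat.rfindOpt (search (p, y)),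
    Partrec.rfindOpt hsearch.to_comp, fun y p t _ ht => (List.append_eq_nil_iff.1 (hdom ht)).2⟩
  have hM (y : BinStr) : M.run [] y = Part.some [true] := by
    obtain ⟨o, ho⟩ := Part.dom_iff_mem.1
      (Nat.rfindOpt_dom.2 ⟨0, [true], by simp [search]⟩ : (Nat.rfindOpt (search ([], y))).Dom)
    obtain ⟨m, hm⟩ := Nat.rfindOpt_spec ho
    have e : [true] = o := by simpa [search] using hm
    exact Part.eq_some_iff.2 (e ▸ ho)
  obtain ⟨c, hc⟩ := hU M
  obtain ⟨q, hq, hrun⟩ := hc []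
  refine ⟨c, (iInf₂_le q fun t => ?_).trans (by exact_mod_cast hq.trans (by simp))⟩
  rw [hrun, hM]
  simp

/-! ### Numerical estimates for logarithms. -/

theorem natSize_le_logb {n : ℕ} (hn : 0 < n) : (Nat.size n : ℝ) ≤ Real.logb 2 n + 1 := by
  have h1 : 2 ^ (Nat.size n - 1) ≤ n := Nat.lt_size.1 (by have := Nat.size_pos.2 hn; lia)
  have h2 : ((Nat.size n - 1 : ℕ) : ℝ) ≤ Real.logb 2 n := by
    rw [Real.le_logb_iff_rpow_le one_lt_two (by exact_mod_cast hn), Real.rpow_natCast]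
    exact_mod_cast h1
  rw [Nat.cast_sub (Nat.size_pos.2 hn)] at h2
  push_cast at h2
  linarith

theorem three_halves_le_logb {n : ℕ} (hn : 3 ≤ n) : 3 / 2 ≤ Real.logb 2 n := by
  have h3 : (3 : ℝ) ≤ n := by exact_mod_cast hn
  rw [Real.le_logb_iff_rpow_le one_lt_two (by linarith)]
  refine le_trans ?_ h3
  have h : ((2 : ℝ) ^ (3 / 2 : ℝ)) ^ 2 = 8 := by
    rw [← Real.rpow_natCast, ← Real.rpow_mul two_pos.le]; norm_num
  nlinarith [Real.rpow_nonneg two_pos.le (3 / 2 : ℝ)]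

/-- A positive lower bound lets additive constants be absorbed into a multiple of `log log n`. It
comes from `√2 ≤ 3 / 2`. -/
theorem half_le_logb_logb {n : ℕ} (hn : 3 ≤ n) : 1 / 2 ≤ Real.logb 2 (Real.logb 2 n) := by
  have h := three_halves_le_logb hn
  rw [Real.le_logb_iff_rpow_le one_lt_two (by linarith)]
  refine le_trans ?_ h
  rw [← Real.sqrt_eq_rpow]
  exact Real.sqrt_le_iff.2 ⟨by norm_num, by norm_num⟩

/-- The length of a self-delimiting description of `n`, up to a constant. -/
theorem natSize_add_le_logb (c : ℕ) {n : ℕ} (hn : 3 ≤ n) :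
    ((Nat.size n + 2 * Nat.size (Nat.size n) + c : ℕ) : ℝ) ≤
      Real.logb 2 n + (2 * c + 12) * Real.logb 2 (Real.logb 2 n) := by
  have h0 := three_halves_le_logb hn
  have h1 := natSize_le_logb (n := n) (by lia)
  have hs : 0 < Nat.size n := Nat.size_pos.2 (by lia)
  have h2 := natSize_le_logb hs
  have h3 : Real.logb 2 (Nat.size n) ≤ 1 + Real.logb 2 (Real.logb 2 n) := by
    rw [← Real.logb_self_eq_one one_lt_two, ← Real.logb_mul two_ne_zero (by linarith)]
    exact Real.logb_le_logb_of_le one_lt_two (by exact_mod_cast hs) (by linarith)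
  have h4 := half_le_logb_logb hn
  have h5 : (c : ℝ) * 1 ≤ c * (2 * Real.logb 2 (Real.logb 2 n)) := by gcongr; linarith
  -- With `L = log n`, the sizes contribute at most `L + 1 + 2 * (2 + log L)`. The constant `5` is
  -- at most `10 * log L`, whence `12`, and `c ≤ 2 * c * log L`.
  push_cast
  nlinarith

/-! ### The main theorem -/

/-- The bound on the constrained effective complexity, with additive constants. -/
theorem PrefixMachine.effComplexityOn_le {U : PrefixMachine} {c₁ c₂ : ℕ}
    (h₁ : ∀ (n : ℕ) (C : Set Ensemble) (hS : (constraintStrings C n).toFinset.Nonempty),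
      U.KEns (uniformEnsemble (constraintStrings C n).toFinset hS) ≤ U.KNat n + U.KSet C + c₁)
    (h₂ : ∀ n : ℕ, U.KNat n ≤ (Nat.size n + 2 * Nat.size (Nat.size n) + c₂ : ℕ))
    {C : Set Ensemble} (hC : ConvexConstraint C) {r n : ℕ} {x : BinStr} (δ : ℝ≥0) {Δ : ℝ≥0}
    (hx : x.length = n) (hr : U.Incompressible r x) (hxC : dirac x ∈ C)
    (hΔ : (r : ℝ≥0∞) + (c₁ : ℝ≥0∞) + (U.KSet C : ℝ≥0∞) ≤ (Δ : ℝ≥0∞)) :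
    U.effComplexityOn δ Δ x C ≤
      (Nat.size n + 2 * Nat.size (Nat.size n) + (c₂ + c₁) : ℕ) + U.KSet C := by
  have hxS : x ∈ (constraintStrings C n).toFinset :=
    List.mem_toFinset.2 (mem_constraintStrings.2 ⟨hx, hxC⟩)
  set S := (constraintStrings C n).toFinset with hS
  have hne : S.Nonempty := ⟨x, hxS⟩
  have hK := h₁ n C hne
  have hcard : S.card ≤ 2 ^ n :=
    (List.toFinset_card_le _).trans (length_constraintStrings_le C n)
  have hH : ENNReal.ofReal (uniformEnsemble S hne).entropy ≤ n := by
    rw [uniformEnsemble_entropy, ← ENNReal.ofReal_natCast]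
    refine ENNReal.ofReal_le_ofReal ?_
    rw [Real.logb_le_iff_le_rpow one_lt_two (by exact_mod_cast hne.card_pos), Real.rpow_natCast]
    exact_mod_cast hcard
  have hinfo : U.totalInfo (uniformEnsemble S hne) ≤ (U.K x : ℝ≥0∞) + Δ := by
    have hK' : (U.KEns (uniformEnsemble S hne) : ℝ≥0∞) ≤
        (U.KNat n : ℝ≥0∞) + (U.KSet C : ℝ≥0∞) + (c₁ : ℝ≥0∞) := by
      have := ENat.toENNReal_le.2 hK
      simpa only [ENat.toENNReal_add, ENat.toENNReal_coe] using this
    have hr' : (n : ℝ≥0∞) + (U.KNat n : ℝ≥0∞) ≤ (U.K x : ℝ≥0∞) + (r : ℝ≥0∞) := by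
      have := ENat.toENNReal_le.2 hr
      simpa only [ENat.toENNReal_add, ENat.toENNReal_coe, hx] using this
    -- Incompressibility trades `n + K(n)` for `K(x) + r`; the remaining overhead is what `Δ` has to
    -- cover.
    calc U.totalInfo (uniformEnsemble S hne)
        ≤ ((U.KNat n : ℝ≥0∞) + (U.KSet C : ℝ≥0∞) + (c₁ : ℝ≥0∞)) + n := add_le_add hK' hH
      _ = ((n : ℝ≥0∞) + U.KNat n) + (c₁ + U.KSet C) := by ring
      _ ≤ ((U.K x : ℝ≥0∞) + r) + (c₁ + U.KSet C) := by gcongr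
      _ = (U.K x : ℝ≥0∞) + (r + c₁ + U.KSet C) := by ring
      _ ≤ (U.K x : ℝ≥0∞) + Δ := by gcongr
  have hmem : uniformEnsemble S hne ∈ U.minDomain δ Δ x ∩ C :=
    ⟨⟨uniformEnsemble_isTypical hne hxS δ, hinfo⟩, hC.uniformEnsemble_mem hne fun s hs =>
      (mem_constraintStrings.1 (List.mem_toFinset.1 hs)).2⟩
  refine (iInf₂_le _ hmem).trans (hK.trans ?_)
  calc U.KNat n + U.KSet C + c₁
      ≤ (Nat.size n + 2 * Nat.size (Nat.size n) + c₂ : ℕ) + U.KSet C + c₁ := by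
        gcongr; exact h₂ n
    _ = _ := by push_cast; ring

theorem mainTheorem4 (U : PrefixMachine) (hU : U.IsUniversal) :
    ∃ (c : ℕ) (A : ℝ), 0 ≤ A ∧
      (∀ (r n : ℕ) (x : BinStr) (δ Δ : ℝ≥0),
        3 ≤ n → x.length = n → U.Incompressible r x →
        (r : ℝ≥0∞) + (c : ℝ≥0∞) ≤ (Δ : ℝ≥0∞) →
        (U.effComplexity δ Δ x : ℝ≥0∞) ≤
          ENNReal.ofReal (Real.logb 2 n + A * Real.logb 2 (Real.logb 2 n))) ∧
      (∀ C : Set Ensemble, ConvexConstraint C → DecidableConstraint C →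
        ∀ (r n : ℕ) (x : BinStr) (δ Δ : ℝ≥0),
        3 ≤ n → x.length = n → U.Incompressible r x → dirac x ∈ C →
        (r : ℝ≥0∞) + (c : ℝ≥0∞) + (U.KSet C : ℝ≥0∞) ≤ (Δ : ℝ≥0∞) →
        (U.effComplexityOn δ Δ x C : ℝ≥0∞) ≤
          ENNReal.ofReal (Real.logb 2 n + A * Real.logb 2 (Real.logb 2 n)) +
            (U.KSet C : ℝ≥0∞)) := by
  obtain ⟨c₁, h₁⟩ := hU.exists_KEns_le
  obtain ⟨c₂, h₂⟩ := hU.exists_KNat_le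
  obtain ⟨c₃, h₃⟩ := hU.exists_KSet_univ_le
  have h₃' : (U.KSet Set.univ : ℝ≥0∞) ≤ c₃ := by
    simpa only [ENat.toENNReal_coe] using ENat.toENNReal_le.2 h₃
  have hbound (k : ℕ) (hk : k ≤ c₂ + c₁ + c₃) {n : ℕ} (hn : 3 ≤ n) :
      ((Nat.size n + 2 * Nat.size (Nat.size n) + k : ℕ) : ℝ≥0∞) ≤ ENNReal.ofReal
        (Real.logb 2 n + (2 * (c₂ + c₁ + c₃ : ℕ) + 12) * Real.logb 2 (Real.logb 2 n)) := by
    rw [← ENNReal.ofReal_natCast]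
    refine ENNReal.ofReal_le_ofReal (le_trans ?_ (natSize_add_le_logb _ hn))
    exact_mod_cast Nat.add_le_add_left hk _
  -- The `c₃` pays for the complexity of `Set.univ` in the unconstrained case; the constrained case
  -- needs only `c₁` and `c₂`.
  refine ⟨c₁ + c₃, 2 * (c₂ + c₁ + c₃ : ℕ) + 12, by positivity, ?_, ?_⟩
  · intro r n x δ Δ hn hx hr hΔ
    have h := PrefixMachine.effComplexityOn_le h₁ h₂ (C := Set.univ) (Δ := Δ)
      (fun _ _ _ _ _ _ _ _ => Set.mem_univ _) δ hx hr (Set.mem_univ _) (by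
        refine le_trans ?_ hΔ
        push_cast
        rw [← add_assoc]
        gcongr)
    have h' : U.effComplexity δ Δ x ≤
        (Nat.size n + 2 * Nat.size (Nat.size n) + (c₂ + c₁ + c₃) : ℕ) := by
      rw [PrefixMachine.effComplexityOn, Set.inter_univ] at h
      refine h.trans ((add_le_add_right h₃ _).trans (le_of_eq ?_))
      push_cast
      ring
    refine le_trans ?_ (hbound _ le_rfl hn)
    simpa only [ENat.toENNReal_coe] using ENat.toENNReal_le.2 h'
  · intro C hC _ r n x δ Δ hn hx hr hxC hΔ
    have h := PrefixMachine.effComplexityOn_le h₁ h₂ hC (Δ := Δ) δ hx hr hxC (by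
      refine le_trans ?_ hΔ
      gcongr
      exact Nat.le_add_right _ _)
    have h' := ENat.toENNReal_le.2 h
    rw [ENat.toENNReal_add, ENat.toENNReal_coe] at h'
    exact h'.trans (add_le_add_left (hbound _ (Nat.le_add_right _ _) hn) _)
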